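/- Let $N\ge 1$, let $\Omega\subset\mathbb R^N$ be a bounded open set, let $a,b\in C(\overline\Omega)$ be real-valued (they may change sign), and let $1<q<2$, $\alpha>1$, $\beta>1$, with $\alpha+\beta<\frac{2N}{N-2}$ if $N>2$. Put $W=H_0^1(\Omega)\times H_0^1(\Omega)$ and, for $\lambda>0$ and $(u,v)\in W$, $$J_\lambda(u,v)=\frac12\int_\Omega\big(|\nabla u|^2+|\nabla v|^2\big)\,dx-\frac{\lambda}{q}\int_\Omega a\big(|u|^q+|v|^q\big)\,dx-\frac1{\alpha+\beta}\int_\Omega b\,|u|^\alpha|v|^\beta\,dx .$$ Let $\phi_{u,v}(t)=J_\lambda(tu,tv)$ be the fibering maps, let $\psi_\lambda(u,v)=\langle J_\lambda'(u,v),(u,v)\rangle$ be the derivative of $J_\lambda$ at $(u,v)$ in the direction $(u,v)$, and let $$M_\lambda(\Omega)=\{(u,v)\in W\setminus\{(0,0)\}:\psi_\lambda(u,v)=0\},\qquad M^0_\lambda(\Omega)=\{(u,v)\in M_\lambda(\Omega):\langle\psi_\lambda'(u,v),(u,v)\rangle=0\},$$ where $\langle\psi_\lambda'(u,v),(u,v)\rangle$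 is again the derivative in the direction $(u,v)$. Call $\lambda_1>0$ a *fibering threshold* if, for every $0<\lambda<\lambda_1$ and every $(u,v)\in W\setminus\{(0,0)\}$, there is $t>0$ with $\phi_{u,v}(t)>0$. Then a fibering threshold exists, and for every fibering threshold $\lambda_1$, $$M^0_\lambda(\Omega)=\emptyset\qquad\text{whenever } 0<\lambda<\lambda_1 .$$ -/

import Mathlib

open MeasureTheory
open scoped ContDiff

noncomputable section

namespace LaplacianSystem

/-- The Euclidean space `ℝ^N`. -/
abbrev Space (N : ℕ) : Type := EuclideanSpace ℝ (Fin N)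

/-- The ambient space `L²(Ω) × L²(Ω; ℝ^N)` in which a Sobolev function `u` is recorded
together with its weak gradient, as `(u, ∇u)`. -/
abbrev GradPair {N : ℕ} (Ω : Set (Space N)) : Type :=
  Lp ℝ 2 (volume.restrict Ω) × Lp (Space N) 2 (volume.restrict Ω)

/-- `φ ∈ C_c^∞(Ω)`. -/
structure IsTestFunction {N : ℕ} (Ω : Set (Space N)) (φ : Space N → ℝ) : Prop where
  smooth : ContDiff ℝ ∞ φ
  compact : HasCompactSupport φ
  support : tsupport φ ⊆ Ω

/-- The subspace `{(φ, ∇φ) : φ ∈ C_c^∞(Ω)}` of `L²(Ω) × L²(Ω; ℝ^N)`. -/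
def testPairs {N : ℕ} (Ω : Set (Space N)) : Submodule ℝ (GradPair Ω) where
  carrier := {p | ∃ φ : Space N → ℝ, IsTestFunction Ω φ ∧
    p.1 =ᵐ[volume.restrict Ω] φ ∧ p.2 =ᵐ[volume.restrict Ω] gradient φ}
  zero_mem' := by
    refine ⟨0, ⟨contDiff_const, HasCompactSupport.zero, by simp [tsupport]⟩, ?_, ?_⟩
    · exact Lp.coeFn_zero _ _ _
    · filter_upwards [Lp.coeFn_zero (Space N) 2 (volume.restrict Ω)] with x hx
      simpa [gradient] using hx
  add_mem' := by
    rintro p p' ⟨φ, hφ, h1, h2⟩ ⟨φ', hφ', h1', h2'⟩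
    refine ⟨φ + φ', ⟨hφ.smooth.add hφ'.smooth, hφ.compact.add hφ'.compact,
      (tsupport_add φ φ').trans (Set.union_subset hφ.support hφ'.support)⟩, ?_, ?_⟩
    · filter_upwards [Lp.coeFn_add p.1 p'.1, h1, h1'] with x hx hx1 hx2
      change (p.1 + p'.1 : Lp ℝ 2 (volume.restrict Ω)) x = _
      rw [hx, Pi.add_apply, hx1, hx2, Pi.add_apply]
    · filter_upwards [Lp.coeFn_add p.2 p'.2, h2, h2'] with x hx hx1 hx2
      have d := (hφ.smooth.differentiable (by simp)) x
      have d' := (hφ'.smooth.differentiable (by simp)) x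
      change (p.2 + p'.2 : Lp (Space N) 2 (volume.restrict Ω)) x = _
      rw [hx, Pi.add_apply, hx1, hx2]
      simp [gradient, fderiv_add d d']
  smul_mem' := by
    rintro c p ⟨φ, hφ, h1, h2⟩
    refine ⟨c • φ, ⟨hφ.smooth.const_smul c, hφ.compact.smul_left (f := fun _ => c),
      (closure_mono (Function.support_const_smul_subset c φ)).trans hφ.support⟩, ?_, ?_⟩
    · filter_upwards [Lp.coeFn_smul c p.1, h1] with x hx hx1
      simp [hx, hx1]
    · filter_upwards [Lp.coeFn_smul c p.2, h2] with x hx hx1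
      have d := (hφ.smooth.differentiable (by simp)) x
      simp [hx, hx1, gradient, fderiv_const_smul d]

/-- The Sobolev space `H₀¹(Ω) = W₀^{1,2}(Ω)`: the closure of `C_c^∞(Ω)` with respect to the
`H¹`-norm. An element is the pair `(u, ∇u)`; the relation "`g` is the weak gradient of `u`" is
closed in `L²(Ω) × L²(Ω; ℝ^N)`, so the second component is the weak gradient of the first one and
is determined by it. -/
def H01 {N : ℕ} (Ω : Set (Space N)) : Submodule ℝ (GradPair Ω) :=
  (testPairs Ω).topologicalClosure

/-- The function `u` underlying an element of `H₀¹(Ω)`. -/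
def fn {N : ℕ} {Ω : Set (Space N)} (u : H01 Ω) : Space N → ℝ := u.1.1

/-- The weak gradient `∇u` of an element of `H₀¹(Ω)`. -/
def grad {N : ℕ} {Ω : Set (Space N)} (u : H01 Ω) : Space N → Space N := u.1.2

/-- `W = H₀¹(Ω) × H₀¹(Ω)`. -/
abbrev W {N : ℕ} (Ω : Set (Space N)) : Type := H01 Ω × H01 Ω

/-- The Euler functional of the system,
`J_λ(u,v) = ½ ∫ (|∇u|² + |∇v|²) - (λ/q) ∫ a (|u|^q + |v|^q) - 1/(α+β) ∫ b |u|^α |v|^β`. -/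
def J {N : ℕ} (Ω : Set (Space N)) (a b : Space N → ℝ) (q α β lam : ℝ) (w : W Ω) : ℝ :=
  (1 / 2) * ((∫ x in Ω, ‖grad w.1 x‖ ^ 2) + ∫ x in Ω, ‖grad w.2 x‖ ^ 2)
    - (lam / q) * ((∫ x in Ω, a x * |fn w.1 x| ^ q) + ∫ x in Ω, a x * |fn w.2 x| ^ q)
    - (1 / (α + β)) * ∫ x in Ω, b x * |fn w.1 x| ^ α * |fn w.2 x| ^ β

/-- The fibering map `φ_{u,v}(t) = J_λ(tu, tv)`. -/
def fiberingMap {N : ℕ} (Ω : Set (Space N)) (a b : Space N → ℝ) (q α β lam : ℝ) (w : W Ω)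
    (t : ℝ) : ℝ :=
  J Ω a b q α β lam (t • w)

/-- `ψ_λ(u,v) = ⟨J_λ'(u,v), (u,v)⟩`, the derivative of `J_λ` at `(u,v)` in the direction
`(u,v)`. -/
def psi {N : ℕ} (Ω : Set (Space N)) (a b : Space N → ℝ) (q α β lam : ℝ) (w : W Ω) : ℝ :=
  lineDeriv ℝ (J Ω a b q α β lam) w w

/-- The Nehari manifold `M_λ(Ω) = {(u,v) ∈ W ∖ {(0,0)} : ⟨J_λ'(u,v), (u,v)⟩ = 0}`. -/
def nehari {N : ℕ} (Ω : Set (Space N)) (a b : Space N → ℝ) (q α β lam : ℝ) : Set (W Ω) :=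
  {w | w ≠ 0 ∧ psi Ω a b q α β lam w = 0}

/-- The degenerate part `M⁰_λ(Ω) = {(u,v) ∈ M_λ(Ω) : ⟨ψ_λ'(u,v), (u,v)⟩ = 0}`. -/
def nehariZero {N : ℕ} (Ω : Set (Space N)) (a b : Space N → ℝ) (q α β lam : ℝ) : Set (W Ω) :=
  {w | w ∈ nehari Ω a b q α β lam ∧ lineDeriv ℝ (psi Ω a b q α β lam) w w = 0}

/-- `lam₁ > 0` is a threshold for the fibering maps: for `0 < λ < lam₁`, the map `φ_{u,v}`
takes a positive value on `(0, ∞)`, for every `(u,v) ≠ (0,0)`. -/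
def IsFiberingThreshold {N : ℕ} (Ω : Set (Space N)) (a b : Space N → ℝ) (q α β lam₁ : ℝ) : Prop :=
  0 < lam₁ ∧ ∀ lam : ℝ, 0 < lam → lam < lam₁ →
    ∀ w : W Ω, w ≠ 0 → ∃ t : ℝ, 0 < t ∧ 0 < fiberingMap Ω a b q α β lam w t

end LaplacianSystem

end

noncomputable section

namespace LaplacianSystem

open Filter Topology
open scoped ENNReal NNReal

variable {N : ℕ} {Ω : Set (Space N)}

/-! Put p = α + β, so q < 2 < p. Along the ray through w, the functional is c₁t² − c₂t^q − c₃t^p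
with c₁ ≥ 0 (`J_smul`). If w lies in M⁰, the two degeneracy conditions at t = 1 are linear in (c₂,
c₃) and force both to be explicit nonnegative multiples of c₁. Then (p − q)tφ'(t) = 2c₁[(p − q)t² −
(p − 2)t^q − (2 − q)t^p], which is ≤ 0 by weighted AM-GM. So φ decreases from φ(0) = 0 and is never
positive, contradicting the threshold property (`degenerate_three_powers_nonpos`,
`nehariZero_eq_empty`).

A threshold exists because, by the Sobolev inequality, J ≥ s²/2 − λK(1 + s²) − Ls^p where the total
gradient norm is s (`exists_J_lower_bound`). As p > 2, a small s absorbs the last term; then a small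
λ absorbs the middle one, uniformly in w. -/

/-! ### Sobolev inequality on H₀¹(Ω) -/

/-- A compactly supported `C¹` function on the line `ℝ¹` is bounded by the `L¹` norm of its
derivative. -/
lemma enorm_le_eLpNorm_fderiv_one {u : Space 1 → ℝ} (hu : ContDiff ℝ 1 u)
    (hc : HasCompactSupport u) (x : Space 1) :
    ‖u x‖ₑ ≤ eLpNorm (fderiv ℝ u) 1 volume := by
  let e : ℝ ≃ₗᵢ[ℝ] Space 1 := (OrthonormalBasis.singleton (Fin 1) ℝ).repr
  have hue : ContDiff ℝ 1 (u ∘ e) := hu.comp e.contDiff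
  have hce : HasCompactSupport (u ∘ e) := hc.comp_homeomorph e.toHomeomorph
  have hd (y : ℝ) : ‖deriv (u ∘ e) y‖ₑ ≤ ‖fderiv ℝ u (e y)‖ₑ := by
    have h1 : HasDerivAt (u ∘ e) (fderiv ℝ u (e y) (e 1)) y := by
      have h2 := (hu.differentiable one_ne_zero (e y)).hasFDerivAt.comp y
        (e.toContinuousLinearEquiv.hasFDerivAt (x := y))
      simpa using h2.hasDerivAt
    rw [h1.deriv, enorm_le_iff_norm_le]
    simpa using (fderiv ℝ u (e y)).le_opNorm (e 1)
  calc ‖u x‖ₑ = ‖(u ∘ e) (e.symm x)‖ₑ := by simp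
    _ ≤ ∫⁻ y in Set.Iic (e.symm x), ‖deriv (u ∘ e) y‖ₑ := hce.enorm_le_lintegral_Ici_deriv hue _
    _ ≤ ∫⁻ y, ‖deriv (u ∘ e) y‖ₑ := lintegral_mono' Measure.restrict_le_self le_rfl
    _ ≤ ∫⁻ y, ‖fderiv ℝ u (e y)‖ₑ := lintegral_mono hd
    _ = ∫⁻ z, ‖fderiv ℝ u z‖ₑ :=
      e.measurePreserving.lintegral_comp_emb e.toHomeomorph.measurableEmbedding
        (fun z => ‖fderiv ℝ u z‖ₑ)
    _ = eLpNorm (fderiv ℝ u) 1 volume := by rw [eLpNorm_one_eq_lintegral_enorm]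

/-- For `p ≥ 2` up to the critical exponent, the `Lᵖ` norm of a `C¹` function supported in a bounded
set is controlled by the `Lʳ` norm of its derivative, for some `r ≤ 2`. -/
lemma exists_eLpNorm_le_eLpNorm_fderiv (hN : 1 ≤ N) (hΩb : Bornology.IsBounded Ω)
    {p : ℝ≥0} (hp : 2 ≤ p) (hpN : 2 < N → (p : ℝ) ≤ 2 * (N : ℝ) / ((N : ℝ) - 2)) :
    ∃ r : ℝ≥0, r ≤ 2 ∧ ∃ C : ℝ≥0, ∀ u : Space N → ℝ, ContDiff ℝ 1 u → HasCompactSupport u →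
      u.support ⊆ Ω → eLpNorm u p volume ≤ C * eLpNorm (fderiv ℝ u) r volume := by
  have hp' : (2 : ℝ) ≤ p := by exact_mod_cast hp
  rcases hN.eq_or_lt with rfl | hN1
  · refine ⟨1, one_le_two, (volume Ω).toNNReal ^ (1 / (p : ℝ)), fun u hu hc hs => ?_⟩
    have hfin : volume Ω ≠ ⊤ := hΩb.measure_lt_top.ne
    calc eLpNorm u p volume = eLpNorm u p (volume.restrict Ω) := by
          rw [eLpNorm_restrict_eq_of_support_subset hs]
      _ ≤ eLpNorm (fun _ : Space 1 => eLpNorm (fderiv ℝ u) 1 volume) p (volume.restrict Ω) :=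
          eLpNorm_mono_enorm fun x => by
            simpa using enorm_le_eLpNorm_fderiv_one hu hc x
      _ = _ := by
          rw [eLpNorm_const' _ (by positivity) (by simp)]
          rw [ENNReal.coe_rpow_of_nonneg _ (by positivity), ENNReal.coe_toNNReal hfin, mul_comm]
          simp
  rcases (show 2 ≤ N from hN1).eq_or_lt with rfl | hN2
  · have hlt : 2 * p / (p + 2) < 2 := by
      rw [div_lt_iff₀ (by positivity)]
      rw [← NNReal.coe_lt_coe]; push_cast; linarith
    -- In dimension 2 the exponent 2 is critical, so r < 2 is taken with Sobolev conjugate exactly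
    -- p: 1/r − 1/2 = 1/p.
    refine ⟨2 * p / (p + 2), hlt.le, _, fun u hu _ hs =>
      eLpNorm_le_eLpNorm_fderiv_of_le volume hu hs ?_ ?_ ?_ hΩb⟩
    · rw [one_le_div (by positivity), ← NNReal.coe_le_coe]; push_cast; linarith
    · simpa using hlt
    · simp only [finrank_euclideanSpace, Fintype.card_fin]
      push_cast
      have : (p : ℝ) ≠ 0 := by positivity
      apply le_of_eq
      field_simp
      ring
  · have hN3 : (2 : ℝ) < N := by exact_mod_cast hN2
    refine ⟨2, le_rfl, _, fun u hu _ hs =>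
      eLpNorm_le_eLpNorm_fderiv_of_le volume hu hs one_le_two ?_ ?_ hΩb⟩
    · simpa using hN2
    · have h := hpN hN2
      rw [le_div_iff₀ (by linarith)] at h
      simp only [finrank_euclideanSpace, Fintype.card_fin]
      push_cast
      have h0 : (0 : ℝ) < p := by linarith
      rw [inv_sub_inv (by norm_num) (by linarith), inv_eq_one_div,
        div_le_div_iff₀ (by linarith) h0]
      linarith

/-- The Sobolev inequality `‖φ‖_p ≤ C ‖∇φ‖_2` for test functions on a bounded set. -/
lemma exists_eLpNorm_le_eLpNorm_gradient (hN : 1 ≤ N) (hΩb : Bornology.IsBounded Ω)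
    {p : ℝ≥0} (hp : 2 ≤ p) (hpN : 2 < N → (p : ℝ) ≤ 2 * (N : ℝ) / ((N : ℝ) - 2)) :
    ∃ C : ℝ≥0, ∀ u : Space N → ℝ, IsTestFunction Ω u →
      eLpNorm u p (volume.restrict Ω) ≤ C * eLpNorm (gradient u) 2 (volume.restrict Ω) := by
  obtain ⟨r, hr2, C, hC⟩ := exists_eLpNorm_le_eLpNorm_fderiv hN hΩb hp hpN
  set k : ℝ≥0∞ := (volume.restrict Ω) Set.univ ^ (1 / (r : ℝ≥0∞).toReal - 1 / (2 : ℝ≥0∞).toReal)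
  -- The case r = 0 is not excluded by the previous lemma; there the right-hand seminorm is zero by
  -- convention, and the Hölder exponent in `k` would be negative.
  by_cases hr0 : r = 0
  · refine ⟨0, fun u hu => ?_⟩
    have := hC u (hu.smooth.of_le (by simp)) hu.compact ((subset_tsupport u).trans hu.support)
    rw [hr0] at this
    calc _ ≤ _ := eLpNorm_mono_measure u Measure.restrict_le_self
      _ ≤ _ := this
      _ = 0 := by simp
      _ ≤ _ := zero_le
  have hkfin : k ≠ ⊤ := by
    refine ENNReal.rpow_ne_top_of_nonneg ?_ ?_
    · rw [sub_nonneg]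
      simp only [ENNReal.coe_toReal, ENNReal.toReal_ofNat]
      exact one_div_le_one_div_of_le (by positivity) (by exact_mod_cast hr2)
    · simpa using hΩb.measure_lt_top.ne
  refine ⟨C * k.toNNReal, fun u hu => ?_⟩
  have hu1 : ContDiff ℝ 1 u := hu.smooth.of_le (by simp)
  have hgc : Continuous (gradient u) :=
    (InnerProductSpace.toDual ℝ (Space N)).symm.continuous.comp (hu1.continuous_fderiv one_ne_zero)
  have hgs : (gradient u).support ⊆ Ω := fun x hx =>
    hu.support (support_fderiv_subset ℝ fun h => hx (by simp [gradient, h]))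
  calc eLpNorm u p (volume.restrict Ω) ≤ eLpNorm u p volume :=
        eLpNorm_mono_measure u Measure.restrict_le_self
    _ ≤ C * eLpNorm (fderiv ℝ u) r volume :=
        hC u hu1 hu.compact ((subset_tsupport u).trans hu.support)
    _ = C * eLpNorm (gradient u) r volume := by
        congr 1
        exact eLpNorm_congr_norm_ae (Eventually.of_forall fun x => by simp [gradient])
    _ = C * eLpNorm (gradient u) r (volume.restrict Ω) := by
        rw [eLpNorm_restrict_eq_of_support_subset hgs]
    _ ≤ C * (eLpNorm (gradient u) 2 (volume.restrict Ω) * k) := by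
        gcongr
        exact eLpNorm_le_eLpNorm_mul_rpow_measure_univ (by exact_mod_cast hr2)
          hgc.aestronglyMeasurable
    _ = _ := by
        rw [ENNReal.coe_mul, ENNReal.coe_toNNReal hkfin]; ring

/-- The Sobolev inequality `‖u‖_p ≤ C ‖∇u‖_2` on `H₀¹(Ω)`, for `Ω` bounded. -/
theorem exists_eLpNorm_fn_le (hN : 1 ≤ N) (hΩb : Bornology.IsBounded Ω)
    {p : ℝ≥0} (hp : 2 ≤ p) (hpN : 2 < N → (p : ℝ) ≤ 2 * (N : ℝ) / ((N : ℝ) - 2)) :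
    ∃ C : ℝ≥0, ∀ u : H01 Ω,
      eLpNorm (fn u) p (volume.restrict Ω) ≤ C * eLpNorm (grad u) 2 (volume.restrict Ω) := by
  obtain ⟨C, hC⟩ := exists_eLpNorm_le_eLpNorm_gradient hN hΩb hp hpN
  refine ⟨C, fun u => ?_⟩
  obtain ⟨s, hs, hlim⟩ := mem_closure_iff_seq_limit.1
    (show (u : GradPair Ω) ∈ closure (testPairs Ω : Set (GradPair Ω)) from u.2)
  have hlim1 : Tendsto (fun n => (s n).1) atTop (𝓝 (u : GradPair Ω).1) :=
    (continuous_fst.tendsto _).comp hlim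
  have hlim2 : Tendsto (fun n => (s n).2) atTop (𝓝 (u : GradPair Ω).2) :=
    (continuous_snd.tendsto _).comp hlim
  -- Only L² convergence is known, so the Lᵖ bound passes to the limit by Fatou along an a.e.
  -- convergent subsequence.
  obtain ⟨ns, hns, hae⟩ := (tendstoInMeasure_of_tendsto_Lp hlim1).exists_seq_tendsto_ae
  have hbound (n : ℕ) : eLpNorm (s n).1 p (volume.restrict Ω) ≤ C * ‖(s n).2‖ₑ := by
    obtain ⟨φ, hφ, h1, h2⟩ := hs n
    rw [Lp.enorm_def, eLpNorm_congr_ae h1, eLpNorm_congr_ae h2]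
    exact hC φ hφ
  have hlim3 : Tendsto (fun n => C * ‖(s (ns n)).2‖ₑ) atTop (𝓝 (C * ‖(u : GradPair Ω).2‖ₑ)) :=
    ENNReal.Tendsto.const_mul ((continuous_enorm.tendsto _).comp
      (hlim2.comp hns.tendsto_atTop)) (Or.inr ENNReal.coe_ne_top)
  calc eLpNorm (fn u) p (volume.restrict Ω)
      ≤ liminf (fun n => eLpNorm (s (ns n)).1 p (volume.restrict Ω)) atTop :=
        Lp.eLpNorm_lim_le_liminf_eLpNorm (fun n => Lp.aestronglyMeasurable _) _ hae
    _ ≤ liminf (fun n => C * ‖(s (ns n)).2‖ₑ) atTop :=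
        liminf_le_liminf (Eventually.of_forall fun n => hbound _)
    _ = C * ‖(u : GradPair Ω).2‖ₑ := hlim3.liminf_eq
    _ = _ := by rw [Lp.enorm_def]; rfl

/-! ### Fibering maps as sums of three powers -/

lemma fn_smul_ae (t : ℝ) (u : H01 Ω) :
    fn (t • u) =ᵐ[volume.restrict Ω] fun x => t * fn u x :=
  Lp.coeFn_smul t u.1.1

lemma integral_norm_grad_sq (u : H01 Ω) : ∫ x in Ω, ‖grad u x‖ ^ 2 = ‖(u : GradPair Ω).2‖ ^ 2 := by
  have h := (Lp.memLp (u : GradPair Ω).2).eLpNorm_eq_integral_rpow_norm two_ne_zero (by simp)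
  rw [Lp.norm_def, h, ENNReal.toReal_ofReal (by positivity)]
  simp only [ENNReal.toReal_ofNat, Real.rpow_two]
  rw [← Real.rpow_natCast, ← Real.rpow_mul (by positivity)]
  simp [grad]

/-- Along the ray through `w`, the functional is a combination of three powers. -/
lemma J_smul {a b : Space N → ℝ} {q α β lam : ℝ} {t : ℝ} (ht : 0 < t) (w : W Ω) :
    J Ω a b q α β lam (t • w) =
      (1 / 2) * ((∫ x in Ω, ‖grad w.1 x‖ ^ 2) + ∫ x in Ω, ‖grad w.2 x‖ ^ 2) * t ^ (2 : ℝ)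
      - (lam / q) * ((∫ x in Ω, a x * |fn w.1 x| ^ q) + ∫ x in Ω, a x * |fn w.2 x| ^ q) * t ^ q
      - (1 / (α + β)) * (∫ x in Ω, b x * |fn w.1 x| ^ α * |fn w.2 x| ^ β) * t ^ (α + β) := by
  have hA (u : H01 Ω) : ∫ x in Ω, ‖grad (t • u) x‖ ^ 2 = (∫ x in Ω, ‖grad u x‖ ^ 2) * t ^ 2 := by
    simp only [integral_norm_grad_sq]
    change ‖t • (u : GradPair Ω).2‖ ^ 2 = _
    rw [norm_smul, mul_pow, Real.norm_eq_abs, sq_abs, mul_comm]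
  have hB (u : H01 Ω) : ∫ x in Ω, a x * |fn (t • u) x| ^ q =
      (∫ x in Ω, a x * |fn u x| ^ q) * t ^ q := by
    rw [← integral_mul_const]
    refine integral_congr_ae ?_
    filter_upwards [fn_smul_ae t u] with x hx
    rw [hx, abs_mul, abs_of_pos ht, Real.mul_rpow ht.le (abs_nonneg _)]
    ring
  have hD : ∫ x in Ω, b x * |fn (t • w.1) x| ^ α * |fn (t • w.2) x| ^ β =
      (∫ x in Ω, b x * |fn w.1 x| ^ α * |fn w.2 x| ^ β) * t ^ (α + β) := by
    rw [← integral_mul_const]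
    refine integral_congr_ae ?_
    filter_upwards [fn_smul_ae t w.1, fn_smul_ae t w.2] with x hx hy
    rw [hx, hy, abs_mul, abs_mul, abs_of_pos ht, Real.mul_rpow ht.le (abs_nonneg _),
      Real.mul_rpow ht.le (abs_nonneg _), Real.rpow_add ht]
    ring
  rw [J, Prod.smul_fst, Prod.smul_snd, Real.rpow_two]
  linear_combination (1 / 2) * (hA w.1 + hA w.2) - (lam / q) * (hB w.1 + hB w.2)
    - (1 / (α + β)) * hD

/-- Factoring out t⁻¹ keeps the same three exponents, so the sign analysis and the second
differentiation reuse the same shape. -/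
lemma hasDerivAt_three_powers {c₁ c₂ c₃ r s p t : ℝ} (ht : 0 < t) :
    HasDerivAt (fun t : ℝ => c₁ * t ^ r - c₂ * t ^ s - c₃ * t ^ p)
      (t⁻¹ * (r * c₁ * t ^ r - s * c₂ * t ^ s - p * c₃ * t ^ p)) t := by
  have h (r : ℝ) : HasDerivAt (fun t : ℝ => t ^ r) (t⁻¹ * (r * t ^ r)) t := by
    convert Real.hasDerivAt_rpow_const (p := r) (Or.inl ht.ne') using 1
    rw [Real.rpow_sub_one ht.ne']; ring
  refine ((((h r).const_mul c₁).sub ((h s).const_mul c₂)).sub ((h p).const_mul c₃)).congr_deriv ?_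
  ring

/-- The derivative at `w`, in the direction `w`, of a function which is a combination of three
powers along the ray through `w`. -/
lemma lineDeriv_self_of_three_powers {E : Type*} [AddCommGroup E] [Module ℝ E] {F : E → ℝ} {w : E}
    {c₁ c₂ c₃ r s p : ℝ}
    (hF : ∀ t : ℝ, 0 < t → F (t • w) = c₁ * t ^ r - c₂ * t ^ s - c₃ * t ^ p) :
    lineDeriv ℝ F w w = r * c₁ - s * c₂ - p * c₃ := by
  have h1 : HasDerivAt (fun t : ℝ => F ((1 + t) • w)) (r * c₁ - s * c₂ - p * c₃) 0 := by
    have h := (hasDerivAt_three_powers (c₁ := c₁) (c₂ := c₂) (c₃ := c₃) (r := r) (s := s) (p := p)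
      (t := 1 + 0) (by norm_num)).comp_const_add 1 0
    simp only [add_zero, inv_one, Real.one_rpow, mul_one, one_mul] at h
    refine h.congr_of_eventuallyEq ?_
    -- The power formula holds only on the open ray, so 1 + t > 0 is needed near t = 0.
    filter_upwards [lt_mem_nhds (show (-1 : ℝ) < 0 by norm_num)] with t ht
    exact hF _ (by linarith)
  have h2 : (fun t : ℝ => F (w + t • w)) = fun t : ℝ => F ((1 + t) • w) := by
    ext t; rw [add_smul, one_smul]
  rw [lineDeriv, h2, h1.deriv]

/-- A combination of three powers with a degenerate critical point at `1` is nonpositive. -/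
lemma degenerate_three_powers_nonpos {c₁ c₂ c₃ q p : ℝ} (hq : 0 < q) (hq2 : q < 2) (hp : 2 < p)
    (hc : 0 ≤ c₁) (h1 : 2 * c₁ - q * c₂ - p * c₃ = 0)
    (h2 : 2 * (2 * c₁) - q * (q * c₂) - p * (p * c₃) = 0) {t : ℝ} (ht : 0 < t) :
    c₁ * t ^ (2 : ℝ) - c₂ * t ^ q - c₃ * t ^ p ≤ 0 := by
  have hp0 : p ≠ 0 := by positivity
  have hpq : 0 < p - q := by linarith
  -- The weights write 2 as a convex combination of q and p.
  have amgm (s : ℝ) (hs : 0 < s) :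
      (p - q) * s ^ (2 : ℝ) ≤ (p - 2) * s ^ q + (2 - q) * s ^ p := by
    have h := Real.geom_mean_le_arith_mean2_weighted (w₁ := (p - 2) / (p - q))
      (w₂ := (2 - q) / (p - q)) (p₁ := s ^ q) (p₂ := s ^ p)
      (div_nonneg (by linarith) hpq.le) (div_nonneg (by linarith) hpq.le) (by positivity)
      (by positivity) (by field_simp; ring)
    rw [← Real.rpow_mul hs.le, ← Real.rpow_mul hs.le, ← Real.rpow_add hs,
      show q * ((p - 2) / (p - q)) + p * ((2 - q) / (p - q)) = 2 by field_simp; ring] at h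
    calc (p - q) * s ^ (2 : ℝ)
        ≤ (p - q) * ((p - 2) / (p - q) * s ^ q + (2 - q) / (p - q) * s ^ p) := by gcongr
      _ = _ := by field_simp
  -- Solution of the degeneracy system for c₂ and c₃ in terms of c₁.
  have e2 : (p - q) * (q * c₂) = 2 * c₁ * (p - 2) := by linear_combination h2 - p * h1
  have e3 : (p - q) * (p * c₃) = 2 * c₁ * (2 - q) := by linear_combination q * h1 - h2
  have hcont : ContinuousOn (fun t : ℝ => c₁ * t ^ (2 : ℝ) - c₂ * t ^ q - c₃ * t ^ p)
      (Set.Ici 0) := by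
    have h (r : ℝ) (hr : 0 < r) : Continuous fun t : ℝ => t ^ r := Real.continuous_rpow_const hr.le
    exact (((continuous_const.mul (h 2 two_pos)).sub (continuous_const.mul (h q hq))).sub
      (continuous_const.mul (h p (by linarith)))).continuousOn
  have hanti : AntitoneOn (fun t : ℝ => c₁ * t ^ (2 : ℝ) - c₂ * t ^ q - c₃ * t ^ p)
      (Set.Ici 0) := by
    refine antitoneOn_of_deriv_nonpos (convex_Ici 0) hcont (fun s hs => ?_) fun s hs => ?_
    · rw [interior_Ici] at hs
      exact (hasDerivAt_three_powers hs).differentiableAt.differentiableWithinAt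
    · rw [interior_Ici] at hs
      rw [(hasDerivAt_three_powers hs).deriv]
      refine mul_nonpos_of_nonneg_of_nonpos (inv_nonneg.2 (le_of_lt hs)) ?_
      refine nonpos_of_mul_nonpos_right (a := p - q) ?_ hpq
      have := mul_le_mul_of_nonneg_left (amgm s hs) (show 0 ≤ 2 * c₁ by linarith)
      linear_combination this - s ^ q * e2 - s ^ p * e3
  have h := hanti (Set.self_mem_Ici) (Set.mem_Ici.2 ht.le) ht.le
  simpa [Real.zero_rpow hq.ne', Real.zero_rpow hp0] using h

/-- If all fibering maps at level `lam` take a positive value, no point of the Nehari manifold is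
degenerate. -/
theorem nehariZero_eq_empty {a b : Space N → ℝ} {q α β lam : ℝ} (hq : 0 < q) (hq2 : q < 2)
    (hαβ : 2 < α + β)
    (h : ∀ w : W Ω, w ≠ 0 → ∃ t : ℝ, 0 < t ∧ 0 < fiberingMap Ω a b q α β lam w t) :
    nehariZero Ω a b q α β lam = ∅ := by
  refine Set.eq_empty_of_forall_notMem fun w ⟨⟨hw0, hw1⟩, hw2⟩ => ?_
  obtain ⟨t, ht, hpos⟩ := h w hw0
  set c₁ := (1 / 2) * ((∫ x in Ω, ‖grad w.1 x‖ ^ 2) + ∫ x in Ω, ‖grad w.2 x‖ ^ 2)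
  set c₂ := (lam / q) * ((∫ x in Ω, a x * |fn w.1 x| ^ q) + ∫ x in Ω, a x * |fn w.2 x| ^ q)
  set c₃ := (1 / (α + β)) * ∫ x in Ω, b x * |fn w.1 x| ^ α * |fn w.2 x| ^ β
  have hJ (t : ℝ) (ht : 0 < t) : J Ω a b q α β lam (t • w) =
      c₁ * t ^ (2 : ℝ) - c₂ * t ^ q - c₃ * t ^ (α + β) := J_smul ht w
  -- Each radial derivative multiplies a coefficient by its exponent, so ψ is again a three-power
  -- combination along the ray.
  have hpsi (t : ℝ) (ht : 0 < t) : psi Ω a b q α β lam (t • w) =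
      2 * c₁ * t ^ (2 : ℝ) - q * c₂ * t ^ q - (α + β) * c₃ * t ^ (α + β) := by
    rw [psi, lineDeriv_self_of_three_powers (c₁ := c₁ * t ^ (2 : ℝ)) (c₂ := c₂ * t ^ q)
      (c₃ := c₃ * t ^ (α + β)) (r := 2) (s := q) (p := α + β) fun s hs => ?_]
    · ring
    · rw [smul_smul, hJ _ (mul_pos hs ht), Real.mul_rpow hs.le ht.le, Real.mul_rpow hs.le ht.le,
        Real.mul_rpow hs.le ht.le]
      ring
  have e1 : 2 * c₁ - q * c₂ - (α + β) * c₃ = 0 := by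
    rw [← hw1, psi, lineDeriv_self_of_three_powers hJ]
  have e2 := lineDeriv_self_of_three_powers (F := psi Ω a b q α β lam) hpsi
  rw [hw2] at e2
  have hc : 0 ≤ c₁ := by positivity
  have := degenerate_three_powers_nonpos hq hq2 hαβ hc e1 e2.symm ht
  rw [fiberingMap, hJ t ht] at hpos
  linarith

/-! ### Lower bound for the functional and existence of a threshold -/

/-- The Sobolev inequality `∫ |u|^p ≤ C ‖∇u‖^p` on `H₀¹(Ω)`. -/
lemma exists_integral_abs_fn_rpow_le (hN : 1 ≤ N) (hΩb : Bornology.IsBounded Ω)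
    {p : ℝ} (hp : 2 ≤ p) (hpN : 2 < N → p ≤ 2 * (N : ℝ) / ((N : ℝ) - 2)) :
    ∃ C : ℝ, 0 ≤ C ∧ ∀ u : H01 Ω, IntegrableOn (fun x => |fn u x| ^ p) Ω ∧
      ∫ x in Ω, |fn u x| ^ p ≤ C * ‖(u : GradPair Ω).2‖ ^ p := by
  lift p to ℝ≥0 using by linarith
  obtain ⟨C, hC⟩ := exists_eLpNorm_fn_le (Ω := Ω) hN hΩb (p := p) (by exact_mod_cast hp) hpN
  have hp0 : (p : ℝ) ≠ 0 := by positivity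
  have hp0' : (p : ℝ≥0∞) ≠ 0 := by
    simpa using hp0
  refine ⟨(C : ℝ) ^ (p : ℝ), by positivity, fun u => ?_⟩
  have hg : eLpNorm (grad u) 2 (volume.restrict Ω) ≠ ⊤ := Lp.eLpNorm_ne_top _
  have hfin : MemLp (fn u) p (volume.restrict Ω) :=
    ⟨Lp.aestronglyMeasurable _, (hC u).trans_lt (ENNReal.mul_lt_top (by simp) hg.lt_top)⟩
  refine ⟨by simpa [IntegrableOn] using hfin.integrable_norm_rpow hp0' (by simp), ?_⟩
  have h1 := hfin.eLpNorm_eq_integral_rpow_norm hp0' (by simp)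
  have h2 : (∫ x in Ω, |fn u x| ^ (p : ℝ)) ^ (p : ℝ)⁻¹ ≤ C * ‖(u : GradPair Ω).2‖ := by
    have h3 := ENNReal.toReal_mono (ENNReal.mul_ne_top (by simp) hg) (hC u)
    rw [h1, ENNReal.toReal_ofReal (by positivity), ENNReal.toReal_mul] at h3
    simpa [Lp.norm_def, grad] using h3
  have h0 : 0 ≤ ∫ x in Ω, |fn u x| ^ (p : ℝ) := by positivity
  calc ∫ x in Ω, |fn u x| ^ (p : ℝ)
      = ((∫ x in Ω, |fn u x| ^ (p : ℝ)) ^ (p : ℝ)⁻¹) ^ (p : ℝ) := by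
        rw [← Real.rpow_mul h0, inv_mul_cancel₀ hp0, Real.rpow_one]
    _ ≤ (C * ‖(u : GradPair Ω).2‖) ^ (p : ℝ) := by gcongr
    _ = _ := by rw [Real.mul_rpow (by positivity) (by positivity)]

/-- An element of `H₀¹(Ω)` with vanishing gradient is zero. -/
lemma eq_zero_of_grad_eq_zero (hN : 1 ≤ N) (hΩb : Bornology.IsBounded Ω) {u : H01 Ω}
    (hu : (u : GradPair Ω).2 = 0) : u = 0 := by
  obtain ⟨C, hC⟩ := exists_eLpNorm_fn_le (Ω := Ω) hN hΩb (p := 2) le_rfl (fun h => by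
    have : (2 : ℝ) < N := by exact_mod_cast h
    rw [le_div_iff₀ (by linarith)]; push_cast; linarith)
  have h := hC u
  have h1 : eLpNorm (grad u) 2 (volume.restrict Ω) = ‖(u : GradPair Ω).2‖ₑ := by
    rw [Lp.enorm_def]; rfl
  have h2 : eLpNorm (fn u) (2 : ℝ≥0) (volume.restrict Ω) = ‖(u : GradPair Ω).1‖ₑ := by
    rw [Lp.enorm_def]; rfl
  rw [h1, h2, hu, enorm_zero, mul_zero, nonpos_iff_eq_zero, enorm_eq_zero] at h
  exact Subtype.ext (Prod.ext h hu)

lemma exists_abs_le_of_continuousOn_closure (hΩb : Bornology.IsBounded Ω) {a : Space N → ℝ}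
    (ha : ContinuousOn a (closure Ω)) : ∃ M : ℝ, 0 ≤ M ∧ ∀ x ∈ Ω, |a x| ≤ M := by
  obtain ⟨M, hM⟩ := hΩb.isCompact_closure.exists_bound_of_continuousOn ha
  exact ⟨max M 0, le_max_right _ _, fun x hx =>
    (hM x (subset_closure hx)).trans (le_max_left _ _)⟩

lemma rpow_mul_rpow_le_add {x y α β : ℝ} (hx : 0 ≤ x) (hy : 0 ≤ y) (hα : 0 < α) (hβ : 0 < β) :
    x ^ α * y ^ β ≤ x ^ (α + β) + y ^ (α + β) := by
  rcases le_total x y with h | h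
  · calc x ^ α * y ^ β ≤ y ^ α * y ^ β := by gcongr
      _ = y ^ (α + β) := (Real.rpow_add_of_nonneg hy hα.le hβ.le).symm
      _ ≤ _ := le_add_of_nonneg_left (by positivity)
  · calc x ^ α * y ^ β ≤ x ^ α * x ^ β := by gcongr
      _ = x ^ (α + β) := (Real.rpow_add_of_nonneg hx hα.le hβ.le).symm
      _ ≤ _ := le_add_of_nonneg_right (by positivity)

lemma rpow_le_one_add_rpow {x q r : ℝ} (hx : 0 ≤ x) (hq : 0 ≤ q) (hqr : q ≤ r) :
    x ^ q ≤ 1 + x ^ r := by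
  rcases le_total x 1 with h | h
  · exact (Real.rpow_le_one hx h hq).trans (le_add_of_nonneg_right (by positivity))
  · exact (Real.rpow_le_rpow_of_exponent_le h hqr).trans (le_add_of_nonneg_left zero_le_one)

/-- A lower bound for the functional in terms of a common bound `s` for the gradient norms. -/
lemma exists_J_lower_bound (hN : 1 ≤ N) (hΩo : IsOpen Ω) (hΩb : Bornology.IsBounded Ω)
    {a b : Space N → ℝ} (ha : ContinuousOn a (closure Ω)) (hb : ContinuousOn b (closure Ω))
    {q α β : ℝ} (hq1 : 0 < q) (hq2 : q ≤ 2) (hα : 0 < α) (hβ : 0 < β) (hαβ2 : 2 ≤ α + β)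
    (hαβ : 2 < N → α + β ≤ 2 * (N : ℝ) / ((N : ℝ) - 2)) :
    ∃ K L : ℝ, 0 ≤ K ∧ 0 ≤ L ∧ ∀ (lam s : ℝ) (w : W Ω), 0 < lam →
      ‖(w.1 : GradPair Ω).2‖ ≤ s → ‖(w.2 : GradPair Ω).2‖ ≤ s →
      (1 / 2) * (‖(w.1 : GradPair Ω).2‖ ^ 2 + ‖(w.2 : GradPair Ω).2‖ ^ 2)
        - lam * (K * (1 + s ^ 2)) - L * s ^ (α + β) ≤ J Ω a b q α β lam w := by
  obtain ⟨Ma, hMa0, hMa⟩ := exists_abs_le_of_continuousOn_closure hΩb ha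
  obtain ⟨Mb, hMb0, hMb⟩ := exists_abs_le_of_continuousOn_closure hΩb hb
  obtain ⟨C, hC0, hC⟩ := exists_integral_abs_fn_rpow_le (Ω := Ω) hN hΩb (p := 2) le_rfl (fun h => by
    have : (2 : ℝ) < N := by exact_mod_cast h
    rw [le_div_iff₀ (by linarith)]; linarith)
  obtain ⟨D, hD0, hD⟩ := exists_integral_abs_fn_rpow_le (Ω := Ω) hN hΩb hαβ2 hαβ
  set m := volume.real Ω
  have hm0 : 0 ≤ m := measureReal_nonneg
  have : IsFiniteMeasure (volume.restrict Ω) := ⟨by simpa using hΩb.measure_lt_top⟩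
  have hB (u : H01 Ω) (s : ℝ) (hs : ‖(u : GradPair Ω).2‖ ≤ s) :
      ∫ x in Ω, a x * |fn u x| ^ q ≤ Ma * (m + C) * (1 + s ^ 2) := by
    obtain ⟨hi, hle⟩ := hC u
    have hi' : IntegrableOn (fun x => 1 + |fn u x| ^ (2 : ℝ)) Ω := (integrable_const 1).add hi
    have h1 : ∫ x in Ω, a x * |fn u x| ^ q ≤ ∫ x in Ω, Ma * (1 + |fn u x| ^ (2 : ℝ)) := by
      -- Domination by an integrable function suffices; integrability of the left integrand need not
      -- be shown.
      refine (Real.le_norm_self _).trans (norm_integral_le_of_norm_le (hi'.const_mul Ma) ?_)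
      filter_upwards [ae_restrict_mem hΩo.measurableSet] with x hx
      rw [norm_mul, Real.norm_eq_abs, Real.norm_of_nonneg (by positivity)]
      exact mul_le_mul (hMa x hx) (rpow_le_one_add_rpow (abs_nonneg _) hq1.le hq2)
        (by positivity) hMa0
    have h2 : ∫ x in Ω, Ma * (1 + |fn u x| ^ (2 : ℝ)) =
        Ma * (m + ∫ x in Ω, |fn u x| ^ (2 : ℝ)) := by
      rw [integral_const_mul, integral_add (integrable_const 1) hi]
      simp [m]
    have h3 : ‖(u : GradPair Ω).2‖ ^ (2 : ℝ) ≤ s ^ 2 := by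
      rw [Real.rpow_two]; gcongr
    calc _ ≤ Ma * (m + ∫ x in Ω, |fn u x| ^ (2 : ℝ)) := h1.trans h2.le
      _ ≤ Ma * (m + C * s ^ 2) := by
        gcongr; exact hle.trans (by gcongr)
      _ ≤ Ma * (m + C) * (1 + s ^ 2) := by
        rw [mul_assoc]; gcongr; nlinarith [mul_nonneg hm0 (sq_nonneg s)]
  have hDw (w : W Ω) (s : ℝ) (hs1 : ‖(w.1 : GradPair Ω).2‖ ≤ s)
      (hs2 : ‖(w.2 : GradPair Ω).2‖ ≤ s) :
      ∫ x in Ω, b x * |fn w.1 x| ^ α * |fn w.2 x| ^ β ≤ 2 * Mb * D * s ^ (α + β) := by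
    obtain ⟨hi1, hle1⟩ := hD w.1
    obtain ⟨hi2, hle2⟩ := hD w.2
    have h1 : ∫ x in Ω, b x * |fn w.1 x| ^ α * |fn w.2 x| ^ β ≤
        ∫ x in Ω, Mb * (|fn w.1 x| ^ (α + β) + |fn w.2 x| ^ (α + β)) := by
      refine (Real.le_norm_self _).trans (norm_integral_le_of_norm_le ((hi1.add hi2).const_mul Mb) ?_)
      filter_upwards [ae_restrict_mem hΩo.measurableSet] with x hx
      rw [mul_assoc, norm_mul, Real.norm_eq_abs, Real.norm_of_nonneg (by positivity)]
      exact mul_le_mul (hMb x hx) (rpow_mul_rpow_le_add (abs_nonneg _) (abs_nonneg _) hα hβ)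
        (by positivity) hMb0
    rw [integral_const_mul, integral_add hi1 hi2] at h1
    calc _ ≤ _ := h1
      _ ≤ Mb * (D * s ^ (α + β) + D * s ^ (α + β)) := by
        gcongr
        · exact hle1.trans (by gcongr)
        · exact hle2.trans (by gcongr)
      _ = _ := by ring
  refine ⟨2 * (Ma * (m + C)) / q, 2 * Mb * D / (α + β), by positivity, by positivity,
    fun lam s w hlam hs1 hs2 => ?_⟩
  rw [J, integral_norm_grad_sq, integral_norm_grad_sq]
  have e1 : (lam / q) * ((∫ x in Ω, a x * |fn w.1 x| ^ q) + ∫ x in Ω, a x * |fn w.2 x| ^ q) ≤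
      (lam / q) * (Ma * (m + C) * (1 + s ^ 2) + Ma * (m + C) * (1 + s ^ 2)) := by
    gcongr
    · exact hB w.1 s hs1
    · exact hB w.2 s hs2
  have e2 : (1 / (α + β)) * (∫ x in Ω, b x * |fn w.1 x| ^ α * |fn w.2 x| ^ β) ≤
      (1 / (α + β)) * (2 * Mb * D * s ^ (α + β)) := by
    gcongr; exact hDw w s hs1 hs2
  have e3 : (lam / q) * (Ma * (m + C) * (1 + s ^ 2) + Ma * (m + C) * (1 + s ^ 2)) =
      lam * (2 * (Ma * (m + C)) / q * (1 + s ^ 2)) := by ring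
  have e4 : (1 / (α + β)) * (2 * Mb * D * s ^ (α + β)) =
      2 * Mb * D / (α + β) * s ^ (α + β) := by ring
  linarith

/-- For small `lam`, all fibering maps take a positive value. -/
theorem exists_isFiberingThreshold (hN : 1 ≤ N) (hΩo : IsOpen Ω) (hΩb : Bornology.IsBounded Ω)
    {a b : Space N → ℝ} (ha : ContinuousOn a (closure Ω)) (hb : ContinuousOn b (closure Ω))
    {q α β : ℝ} (hq1 : 0 < q) (hq2 : q ≤ 2) (hα : 0 < α) (hβ : 0 < β) (hαβ2 : 2 < α + β)
    (hαβ : 2 < N → α + β ≤ 2 * (N : ℝ) / ((N : ℝ) - 2)) :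
    ∃ lam₁ : ℝ, IsFiberingThreshold Ω a b q α β lam₁ := by
  obtain ⟨K, L, hK, hL, hJ⟩ :=
    exists_J_lower_bound hN hΩo hΩb ha hb hq1 hq2 hα hβ hαβ2.le hαβ
  obtain ⟨s, hs, hsL⟩ : ∃ s : ℝ, 0 < s ∧ L * s ^ (α + β) < s ^ 2 / 4 := by
    have hlim : Tendsto (fun s : ℝ => L * s ^ (α + β - 2)) (𝓝[>] 0) (𝓝 0) := by
      have h : Continuous fun s : ℝ => L * s ^ (α + β - 2) :=
        continuous_const.mul (Real.continuous_rpow_const (by linarith))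
      have h0 := h.tendsto 0
      rw [Real.zero_rpow (by linarith), mul_zero] at h0
      exact h0.mono_left nhdsWithin_le_nhds
    obtain ⟨s, h1, hs⟩ := ((hlim.eventually (gt_mem_nhds (show (0 : ℝ) < 1 / 4 by norm_num))).and
      self_mem_nhdsWithin).exists
    have hs : 0 < s := hs
    refine ⟨s, hs, ?_⟩
    rw [Real.rpow_sub hs, Real.rpow_two, ← mul_div_assoc, div_lt_iff₀ (by positivity)] at h1
    linarith
  -- Below this value λK(1 + s²) < s²/4; the `+ 1` keeps the denominator positive when K = 0.
  refine ⟨s ^ 2 / (4 * (K * (1 + s ^ 2) + 1)), by positivity, fun lam hlam hlam1 w hw => ?_⟩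
  set G := ‖(w.1 : GradPair Ω).2‖ ^ 2 + ‖(w.2 : GradPair Ω).2‖ ^ 2 with hG
  have hGpos : 0 < G := by
    refine lt_of_le_of_ne (by positivity) fun h0 => hw ?_
    have h1 : ‖(w.1 : GradPair Ω).2‖ ^ 2 = 0 := by
      nlinarith [sq_nonneg ‖(w.1 : GradPair Ω).2‖, sq_nonneg ‖(w.2 : GradPair Ω).2‖]
    have h2 : ‖(w.2 : GradPair Ω).2‖ ^ 2 = 0 := by
      nlinarith [sq_nonneg ‖(w.1 : GradPair Ω).2‖, sq_nonneg ‖(w.2 : GradPair Ω).2‖]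
    exact Prod.ext (eq_zero_of_grad_eq_zero hN hΩb
        (norm_eq_zero.1 (pow_eq_zero_iff two_ne_zero |>.1 h1)))
      (eq_zero_of_grad_eq_zero hN hΩb
        (norm_eq_zero.1 (pow_eq_zero_iff two_ne_zero |>.1 h2)))
  have hsq : √G ^ 2 = G := Real.sq_sqrt hGpos.le
  have hsqrt : 0 < √G := Real.sqrt_pos.2 hGpos
  have ht : 0 < s / √G := by positivity
  -- This t rescales the total gradient norm √G to s; the quadratic term s²/2 then beats two terms
  -- each below s²/4.
  refine ⟨s / √G, ht, ?_⟩
  have hnorm (u : H01 Ω) : ‖(((s / √G) • u : H01 Ω) : GradPair Ω).2‖ =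
      s / √G * ‖(u : GradPair Ω).2‖ := by
    change ‖(s / √G) • (u : GradPair Ω).2‖ = _
    rw [norm_smul, Real.norm_of_nonneg ht.le]
  have hle (u : H01 Ω) (hu : ‖(u : GradPair Ω).2‖ ^ 2 ≤ G) :
      ‖(((s / √G) • u : H01 Ω) : GradPair Ω).2‖ ≤ s := by
    rw [hnorm, div_mul_eq_mul_div, div_le_iff₀ hsqrt]
    gcongr
    exact Real.le_sqrt_of_sq_le hu
  have h := hJ lam s ((s / √G) • w) hlam
    (hle w.1 (by rw [hG]; linarith [sq_nonneg ‖(w.2 : GradPair Ω).2‖]))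
    (hle w.2 (by rw [hG]; linarith [sq_nonneg ‖(w.1 : GradPair Ω).2‖]))
  rw [Prod.smul_fst, Prod.smul_snd, hnorm, hnorm, mul_pow, mul_pow, ← mul_add, ← hG, div_pow, hsq,
    div_mul_cancel₀ _ hGpos.ne'] at h
  rw [lt_div_iff₀ (by positivity)] at hlam1
  rw [fiberingMap]
  linarith

end LaplacianSystem

end

theorem corollary2p6 {N : ℕ} (hN : 1 ≤ N) (Ω : Set (LaplacianSystem.Space N))
    (hΩo : IsOpen Ω) (hΩb : Bornology.IsBounded Ω)
    (a b : LaplacianSystem.Space N → ℝ)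
    (ha : ContinuousOn a (closure Ω)) (hb : ContinuousOn b (closure Ω))
    (q α β : ℝ) (hq1 : 1 < q) (hq2 : q < 2) (hα : 1 < α) (hβ : 1 < β)
    (hαβ : 2 < N → α + β < 2 * (N : ℝ) / ((N : ℝ) - 2)) :
    (∃ lam₁ : ℝ, LaplacianSystem.IsFiberingThreshold Ω a b q α β lam₁) ∧
    ∀ lam₁ : ℝ, LaplacianSystem.IsFiberingThreshold Ω a b q α β lam₁ →
      ∀ lam : ℝ, 0 < lam → lam < lam₁ →
        LaplacianSystem.nehariZero Ω a b q α β lam = ∅ := by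

  have hαβ2 : 2 < α + β := by linarith
  exact ⟨LaplacianSystem.exists_isFiberingThreshold hN hΩo hΩb ha hb (by linarith) hq2.le
      (by linarith) (by linarith) hαβ2 fun h => (hαβ h).le,
    fun lam₁ hlam₁ lam hlam hlt => LaplacianSystem.nehariZero_eq_empty (by linarith) hq2 hαβ2
      (hlam₁.2 lam hlam hlt)⟩
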